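/- Let $n\ge 0$ and write $\mathbb M_n=\mathbb C^{n\times n}$. Let $\mathbf{RH}_\infty^{n\times n}$ be the set of $n\times n$ matrices of real-rational functions that are proper and have no poles in the closed right half-plane. For $G\in\mathbf{RH}_\infty^{n\times n}$ put $G(j\infty)=\lim_{|s|\to\infty}G(s)$. Let $\mathbf L_\infty^{n\times n}$ be the set of Lebesgue measurable, essentially bounded functions $H:j\mathbb R\to\mathbb M_n$, each taken as a function defined at every point of $j\mathbb R$ and carrying in addition a value $H(j\infty)\in\mathbb M_n$, which may be arbitrary (no continuity at $\infty$ is required). Write $\preceq$ for the Loewner order on Hermitian matrices. An eigenvalue is semi-simple if its algebraic and geometric multiplicities coincide. **Theorem.** Let $G,K\in\mathbf{RH}_\infty^{n\times n}$ be such that for every $\omega\in[0,\infty]$, if $0$ is an eigenvalue of $G(j\omega)K(j\omega)$, then it is semi-simple. Then the following are equivalent. (a) For every real $\tau>0$, the rational matrix $I+\tau GK$ is invertible and $(I+\tau GK)^{-1}\in\mathbf{RH}_\infty^{n\times n}$. (b) There exists $H\in\mathbf L_\infty^{n\times n}$ such that, with $$\Pi(j\omega)=\begin{bmatrix}0&H(j\omega)\\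 H(j\omega)^*&0\end{bmatrix},$$ for every $\omega\in[0,\infty]$ there is an $\epsilon>0$ (which may depend on $\omega$) with $$\begin{pmatrix}I&-G(j\omega)^*\end{pmatrix}\Pi(j\omega)\begin{pmatrix}I\\-G(j\omega)\end{pmatrix}\preceq-\epsilon\,G(j\omega)^*G(j\omega),\qquad \begin{pmatrix}K(j\omega)^*&I\end{pmatrix}\Pi(j\omega)\begin{pmatrix}K(j\omega)\\I\end{pmatrix}\succeq0.$$ -/

import Mathlib

open scoped Matrix

noncomputable section

namespace PhaseMultiplier

/-- `r` is a proper real-rational function (a constant or vanishing limit at infinity is allowed)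
with no pole in the closed right half-plane. `r.num` and `r.denom` are coprime, so the zeros of
`r.denom` are exactly the poles of `r`. -/
def IsProperStable (r : RatFunc ℝ) : Prop :=
  r.num.natDegree ≤ r.denom.natDegree ∧
    ∀ s : ℂ, 0 ≤ s.re → r.denom.eval₂ (algebraMap ℝ ℂ) s ≠ 0

/-- The space `RH∞^{n × n}`: real-rational proper transfer matrices without poles in the closed
right half-plane. -/
def IsRHInf {n : ℕ} (G : Matrix (Fin n) (Fin n) (RatFunc ℝ)) : Prop :=
  ∀ i j, IsProperStable (G i j)

/-- The value of a proper rational function at infinity, i.e. its limit as `|s| → ∞`: the quotient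
of the coefficients of `s ^ deg denom`. -/
def valueAtInfty (r : RatFunc ℝ) : ℂ :=
  ((r.num.coeff r.denom.natDegree / r.denom.leadingCoeff : ℝ) : ℂ)

/-- The frequency response `ω ↦ G(jω)` on the extended real line `ℝ ∪ {∞}`. -/
def freqResponse {n : ℕ} (G : Matrix (Fin n) (Fin n) (RatFunc ℝ)) :
    OnePoint ℝ → Matrix (Fin n) (Fin n) ℂ
  | none => G.map valueAtInfty
  | some ω => G.map (RatFunc.eval (algebraMap ℝ ℂ) ((ω : ℂ) * Complex.I))

/-- The set of frequencies `[0, ∞]`, with `∞` included. -/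
def nonnegFreq : Set (OnePoint ℝ) :=
  insert OnePoint.infty ((fun ω : ℝ => (ω : OnePoint ℝ)) '' Set.Ici 0)

/-- An eigenvalue is semi-simple if its algebraic and geometric multiplicities agree. -/
def IsSemisimpleEigenvalue {n : ℕ} (A : Matrix (Fin n) (Fin n) ℂ) (μ : ℂ) : Prop :=
  A.charpoly.rootMultiplicity μ =
    Module.finrank ℂ (Module.End.eigenspace (Matrix.toLin' A) μ)

section LInf

open scoped Matrix.Norms.L2Operator

/-- The Lebesgue space `L∞^{n × n}` on the imaginary axis (`φ ω` stands for `φ(jω)`): Lebesgue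
measurable functions whose matrix 2-norm is essentially bounded. -/
def IsLInf {n : ℕ} (φ : ℝ → Matrix (Fin n) (Fin n) ℂ) : Prop :=
  MeasureTheory.MemLp φ ⊤ MeasureTheory.volume

end LInf

/-- The block matrix `[[0, H], [Hᴴ, 0]]`. -/
def phaseMultiplier {n : ℕ} (H : Matrix (Fin n) (Fin n) ℂ) :
    Matrix (Fin n ⊕ Fin n) (Fin n ⊕ Fin n) ℂ :=
  Matrix.fromBlocks 0 H Hᴴ 0

open scoped MatrixOrder in
/-- The pair of quadratic separation inequalities for `A`, `B` with multiplier `P` and constant `ε`;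
`X ≤ Y` is the Loewner order, i.e. `Y - X` is Hermitian and positive semidefinite. -/
def QuadSeparates {n : ℕ} (A B : Matrix (Fin n) (Fin n) ℂ)
    (P : Matrix (Fin n ⊕ Fin n) (Fin n ⊕ Fin n) ℂ) (ε : ℝ) : Prop :=
  (Matrix.fromCols 1 (-Aᴴ) : Matrix (Fin n) (Fin n ⊕ Fin n) ℂ) * P *
        (Matrix.fromRows 1 (-A) : Matrix (Fin n ⊕ Fin n) (Fin n) ℂ) ≤ -((ε : ℂ) • (Aᴴ * A)) ∧
    0 ≤ (Matrix.fromCols Bᴴ 1 : Matrix (Fin n) (Fin n ⊕ Fin n) ℂ) * P *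
        (Matrix.fromRows B 1 : Matrix (Fin n ⊕ Fin n) (Fin n) ℂ)

end PhaseMultiplier

end

/-!
The theorem splits into a statement at a single frequency and a reduction of stability to single
frequencies.

At one frequency put `A = G(jω)`, `B = K(jω)`, `C = A B`. The two quadratic inequalities read
`H A + A* H* ≥ ε A* A` and `H* B + B* H ≥ 0`. They exclude a null vector `x` of `1 + τ C` with `τ > 0`
by evaluating the second at `x` and the first at `B x` (`QuadSeparates.det_ne_zero`). Conversely, with
`H = A* Y*` they follow from `Y + Y* > 0` and `Y C + C* Y* ≥ 0` (`exists_quadSeparates`). If a matrix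
`W` has no eigenvalue in `(-∞, 0]`, a `Y` that makes both `Y` and `Y W` strictly accretive exists by
Hahn–Banach (`exists_strictly_accretive_multiplier`): the obstruction would be a relation
`P + W Q = 0` between positive semidefinite matrices, which gives `W` an eigenvalue `≤ 0` on the range
of `Q`. Semi-simplicity of the eigenvalue `0` of `C` provides the projection `E` onto `ker C` along
the range of `C`; one applies this to `W = C + E` and extends by `E* E` on the kernel
(`IsKernelProjection.isMultiplier_extendMultiplier`).

The multiplier can be chosen measurably in `ω`, since `E` is the limit of `t (C + t)⁻¹` as `t ↓ 0` and
strictness is an open condition, so that `Y` may be taken from a fixed dense sequence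
(`exists_stronglyMeasurable_isMultiplier`). Boundedness is a matter of rescaling, as `ε` may depend
on `ω`.

Stability for all `τ > 0` is equivalent to `det (1 + τ G K)` having no zero on the extended imaginary
axis for any `τ > 0` (`stability_iff_forall_freq`). Starting from `τ = 0`, zeros cannot enter the open
right half-plane: while there are none, the maximum principle for `1 / det (1 + τ G K)` bounds the
determinant below by its minimum over the imaginary axis, uniformly for bounded `τ`
(`evalHom_returnDet_ne_zero`).
-/

noncomputable section

namespace PhaseMultiplier

open Matrix Filter Topology
open scoped ComplexOrder

variable {n : ℕ}

/-! ### Quadratic separation and null vectors -/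

theorem star_dotProduct_conjTranspose_mulVec (M : Matrix (Fin n) (Fin n) ℂ) (v w : Fin n → ℂ) :
    star v ⬝ᵥ Mᴴ *ᵥ w = star (star w ⬝ᵥ M *ᵥ v) := by
  rw [star_dotProduct, star_mulVec, conjTranspose_conjTranspose, ← dotProduct_mulVec]

theorem star_dotProduct_add_conjTranspose_mulVec (M : Matrix (Fin n) (Fin n) ℂ) (v : Fin n → ℂ) :
    star v ⬝ᵥ (M + Mᴴ) *ᵥ v = ((2 * (star v ⬝ᵥ M *ᵥ v).re : ℝ) : ℂ) := by
  rw [add_mulVec, dotProduct_add, star_dotProduct_conjTranspose_mulVec]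
  simpa using Complex.add_conj (star v ⬝ᵥ M *ᵥ v)

theorem posSemidef_add_conjTranspose_iff {M : Matrix (Fin n) (Fin n) ℂ} :
    (M + Mᴴ).PosSemidef ↔ ∀ v, 0 ≤ (star v ⬝ᵥ M *ᵥ v).re := by
  rw [posSemidef_iff_dotProduct_mulVec]
  refine ⟨fun ⟨_, h⟩ v => ?_, fun h => ⟨by simp [IsHermitian, add_comm], fun v => ?_⟩⟩
  · have := h v
    rw [star_dotProduct_add_conjTranspose_mulVec, Complex.zero_le_real] at this
    linarith
  · rw [star_dotProduct_add_conjTranspose_mulVec, Complex.zero_le_real]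
    linarith [h v]

theorem quadSeparates_iff {A B H : Matrix (Fin n) (Fin n) ℂ} {ε : ℝ} :
    QuadSeparates A B (phaseMultiplier H) ε ↔
      (H * A + (H * A)ᴴ - (ε : ℂ) • (Aᴴ * A)).PosSemidef ∧
        (Hᴴ * B + (Hᴴ * B)ᴴ).PosSemidef := by
  unfold QuadSeparates phaseMultiplier
  rw [Matrix.le_iff, Matrix.le_iff]
  have h1 : (fromCols 1 (-Aᴴ) : Matrix (Fin n) (Fin n ⊕ Fin n) ℂ) * fromBlocks 0 H Hᴴ 0 *
      (fromRows 1 (-A) : Matrix (Fin n ⊕ Fin n) (Fin n) ℂ) = -(H * A + (H * A)ᴴ) := by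
    simp [fromCols_mul_fromBlocks, fromCols_mul_fromRows, conjTranspose_mul, add_comm]
  have h2 : (fromCols Bᴴ 1 : Matrix (Fin n) (Fin n ⊕ Fin n) ℂ) * fromBlocks 0 H Hᴴ 0 *
      (fromRows B 1 : Matrix (Fin n ⊕ Fin n) (Fin n) ℂ) = Hᴴ * B + (Hᴴ * B)ᴴ := by
    simp [fromCols_mul_fromBlocks, fromCols_mul_fromRows, conjTranspose_mul, add_comm]
  rw [h1, h2, sub_zero]
  have h3 : -((ε : ℂ) • (Aᴴ * A)) - -(H * A + (H * A)ᴴ) =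
      H * A + (H * A)ᴴ - (ε : ℂ) • (Aᴴ * A) := by abel
  rw [h3]

/-- Quadratic separation of `A` and `B` makes every `1 + τ A B` with `τ > 0` nonsingular: for a null
vector `x` and `u = B x`, the two inequalities give `Re (x* H* u)` opposite signs. -/
theorem QuadSeparates.det_ne_zero {A B H : Matrix (Fin n) (Fin n) ℂ} {ε : ℝ} (hε : 0 < ε)
    (h : QuadSeparates A B (phaseMultiplier H) ε) {τ : ℝ} (hτ : 0 < τ) :
    (1 + (τ : ℂ) • (A * B)).det ≠ 0 := by
  rw [quadSeparates_iff] at h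
  obtain ⟨h1, h2⟩ := h
  intro hdet
  obtain ⟨x, hx0, hx⟩ := exists_mulVec_eq_zero_iff.mpr hdet
  set u := B *ᵥ x with hu
  have hτ' : (τ : ℂ) ≠ 0 := by exact_mod_cast hτ.ne'
  have hAu : A *ᵥ u = ((-τ⁻¹ : ℝ) : ℂ) • x := by
    rw [add_mulVec, one_mulVec, smul_mulVec, ← mulVec_mulVec] at hx
    rw [eq_neg_of_add_eq_zero_left hx, smul_neg, smul_smul]
    simp [inv_mul_cancel₀ hτ', hu, mulVec_mulVec]
  have e1 : 0 ≤ (star x ⬝ᵥ Hᴴ *ᵥ u).re := by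
    have := posSemidef_add_conjTranspose_iff.mp h2 x
    rwa [← mulVec_mulVec] at this
  have e2 : 0 ≤ (star u ⬝ᵥ (H * A + (H * A)ᴴ - (ε : ℂ) • (Aᴴ * A)) *ᵥ u).re :=
    (Complex.le_def.mp (h1.dotProduct_mulVec_nonneg u)).1
  have e3 : star u ⬝ᵥ (Aᴴ * A) *ᵥ u = ((τ⁻¹ ^ 2 : ℝ) : ℂ) * (star x ⬝ᵥ x) := by
    rw [← mulVec_mulVec, star_dotProduct_conjTranspose_mulVec, ← star_dotProduct, hAu]
    simp [star_smul, smul_dotProduct, dotProduct_smul]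
    ring
  have e4 : star u ⬝ᵥ (H * A) *ᵥ u = ((-τ⁻¹ : ℝ) : ℂ) * star (star x ⬝ᵥ Hᴴ *ᵥ u) := by
    rw [star_dotProduct_conjTranspose_mulVec, star_star, ← mulVec_mulVec, hAu, mulVec_smul,
      dotProduct_smul, smul_eq_mul]
  have e5 : 0 < (star x ⬝ᵥ x).re := (Complex.lt_def.mp (dotProduct_star_self_pos_iff.mpr hx0)).1
  rw [sub_mulVec, dotProduct_sub, star_dotProduct_add_conjTranspose_mulVec, smul_mulVec,
    dotProduct_smul, e3, e4, smul_eq_mul, Complex.sub_re, Complex.ofReal_re, Complex.re_ofReal_mul,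
    Complex.re_ofReal_mul, Complex.re_ofReal_mul] at e2
  have e6 : (star (star x ⬝ᵥ Hᴴ *ᵥ u)).re = (star x ⬝ᵥ Hᴴ *ᵥ u).re := rfl
  rw [e6] at e2
  have : 0 < ε * (τ⁻¹ ^ 2 * (star x ⬝ᵥ x).re) := by positivity
  have : 0 ≤ τ⁻¹ * (star x ⬝ᵥ Hᴴ *ᵥ u).re := by positivity
  linarith

/-! ### Strictly accretive multipliers -/

/-- If `P + W Q = 0` with `P`, `Q` positive semidefinite, then `W` maps the range of `Q` into itself
and acts there with eigenvalues `-x* P x / x* Q x ≤ 0`. -/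
theorem eq_zero_of_posSemidef_add_mul_eq_zero {W P Q : Matrix (Fin n) (Fin n) ℂ}
    (hW : ∀ t : ℝ, 0 ≤ t → (W + (t : ℂ) • 1).det ≠ 0) (hP : P.PosSemidef) (hQ : Q.PosSemidef)
    (h : P + W * Q = 0) : Q = 0 := by
  by_contra hQ0
  have hWQ : W * Q = -P := eq_neg_of_add_eq_zero_right h
  have hQW : Q * Wᴴ = -P := by
    have := congrArg conjTranspose hWQ
    rwa [conjTranspose_mul, hQ.isHermitian.eq, conjTranspose_neg, hP.isHermitian.eq] at this
  have hmap : ∀ y ∈ LinearMap.range Q.toLin', W.toLin' y ∈ LinearMap.range Q.toLin' := by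
    rintro _ ⟨x, rfl⟩
    refine ⟨Wᴴ *ᵥ x, ?_⟩
    simp only [toLin'_apply, mulVec_mulVec, hWQ, hQW]
  have : Nontrivial (LinearMap.range Q.toLin') := by
    rw [Submodule.nontrivial_iff_ne_bot, Ne, LinearMap.range_eq_bot]
    simpa using hQ0
  obtain ⟨μ, hμ⟩ := Module.End.exists_eigenvalue (W.toLin'.restrict hmap)
  obtain ⟨⟨y, x, rfl⟩, hy⟩ := hμ.exists_hasEigenvector
  have hy0 : Q *ᵥ x ≠ 0 := fun h0 => hy.2 (Subtype.ext h0)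
  have hWy : W *ᵥ (Q *ᵥ x) = μ • Q *ᵥ x := congrArg Subtype.val hy.apply_eq_smul
  have hPx : P *ᵥ x = -(μ • Q *ᵥ x) := by
    rw [← hWy, mulVec_mulVec, hWQ, neg_mulVec, neg_neg]
  have h1 : 0 ≤ star x ⬝ᵥ P *ᵥ x := hP.dotProduct_mulVec_nonneg x
  have h2 : 0 ≤ star x ⬝ᵥ Q *ᵥ x := hQ.dotProduct_mulVec_nonneg x
  have h3 : star x ⬝ᵥ Q *ᵥ x ≠ 0 := fun h0 => hy0 ((hQ.dotProduct_mulVec_zero_iff x).mp h0)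
  have hμ' : -μ = (star x ⬝ᵥ P *ᵥ x) / (star x ⬝ᵥ Q *ᵥ x) := by
    rw [eq_div_iff h3, hPx, dotProduct_neg, dotProduct_smul, smul_eq_mul, neg_mul]
  have hμ0 : 0 ≤ -μ := hμ' ▸ div_nonneg h1 h2
  obtain ⟨t, ht⟩ : ∃ t : ℝ, (t : ℂ) = -μ :=
    ⟨(-μ).re, Complex.ext rfl (by simpa using (Complex.le_def.mp hμ0).2)⟩
  refine hW t (Complex.zero_le_real.mp (ht ▸ hμ0)) (exists_mulVec_eq_zero_iff.mp ⟨_, hy0, ?_⟩)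
  rw [add_mulVec, smul_mulVec, one_mulVec, hWy, ht, neg_smul, add_neg_cancel]

/-- A linear functional on matrices is `Z ↦ tr (Y Z)`; only its values on rank one matrices matter
here. -/
theorem exists_forall_map_vecMulVec (f : Matrix (Fin n) (Fin n) ℂ →ₗ[ℂ] ℂ) :
    ∃ Y : Matrix (Fin n) (Fin n) ℂ, ∀ v w : Fin n → ℂ,
      f (vecMulVec v (star w)) = star w ⬝ᵥ Y *ᵥ v := by
  refine ⟨of fun i j => f (single j i 1), fun v w => ?_⟩
  rw [matrix_eq_sum_single (vecMulVec v (star w))]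
  simp only [map_sum, dotProduct, mulVec, of_apply, Finset.mul_sum]
  rw [Finset.sum_comm]
  refine Finset.sum_congr rfl fun i _ => Finset.sum_congr rfl fun j _ => ?_
  have : single j i (vecMulVec v (star w) j i) = vecMulVec v (star w) j i • single j i (1 : ℂ) := by
    simp
  rw [this, map_smul, vecMulVec_apply, smul_eq_mul]
  ring

open scoped Matrix.Norms.Elementwise in
/-- The pairs `(B₁, B₂)` of factors of `P = B₁* B₁`, `Q = B₂* B₂` with `tr P + tr Q = 1`; the image
`{P + W Q}` inherits compactness from them. -/
theorem isCompact_setOf_trace_add_trace_eq_one :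
    IsCompact {B : Matrix (Fin n) (Fin n) ℂ × Matrix (Fin n) (Fin n) ℂ |
      (B.1ᴴ * B.1).trace + (B.2ᴴ * B.2).trace = 1} := by
  refine Metric.isCompact_of_isClosed_isBounded (isClosed_eq (by fun_prop) (by fun_prop)) ?_
  refine Metric.isBounded_closedBall (x := 0) (r := 1) |>.subset fun B hB => ?_
  have key : ∀ M : Matrix (Fin n) (Fin n) ℂ,
      (Mᴴ * M).trace.re = ∑ j, ∑ i, ‖M i j‖ ^ 2 := fun M => by
    simp [trace, mul_apply, Complex.conj_mul', ← Complex.ofReal_pow]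
  have entry : ∀ M : Matrix (Fin n) (Fin n) ℂ, (Mᴴ * M).trace.re ≤ 1 → ‖M‖ ≤ 1 := fun M hM => by
    rw [Matrix.norm_le_iff zero_le_one]
    intro i j
    rw [key] at hM
    have h1 : ‖M i j‖ ^ 2 ≤ ∑ i, ‖M i j‖ ^ 2 :=
      Finset.single_le_sum (f := fun i => ‖M i j‖ ^ 2) (fun _ _ => by positivity)
        (Finset.mem_univ i)
    have h2 : ∑ i, ‖M i j‖ ^ 2 ≤ ∑ j, ∑ i, ‖M i j‖ ^ 2 :=
      Finset.single_le_sum (f := fun j => ∑ i, ‖M i j‖ ^ 2) (fun _ _ => by positivity)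
        (Finset.mem_univ j)
    nlinarith [norm_nonneg (M i j)]
  have nonneg : ∀ M : Matrix (Fin n) (Fin n) ℂ, 0 ≤ (Mᴴ * M).trace.re := fun M => by
    rw [key]; positivity
  have hsum : (B.1ᴴ * B.1).trace.re + (B.2ᴴ * B.2).trace.re = 1 := congrArg Complex.re hB
  rw [mem_closedBall_zero_iff, Prod.norm_def]
  exact max_le (entry _ (by linarith [nonneg B.2])) (entry _ (by linarith [nonneg B.1]))

open scoped MatrixOrder Matrix.Norms.L2Operator in
/-- A matrix without eigenvalues in `(-∞, 0]` has a multiplier `Y` making both `Y` and `Y W`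
strictly accretive. Otherwise, by Hahn–Banach, `0` is of the form `P + W Q` with `P`, `Q` positive
semidefinite and not both zero. -/
theorem exists_strictly_accretive_multiplier {W : Matrix (Fin n) (Fin n) ℂ}
    (hW : ∀ t : ℝ, 0 ≤ t → (W + (t : ℂ) • 1).det ≠ 0) :
    ∃ Y : Matrix (Fin n) (Fin n) ℂ, ∀ v : Fin n → ℂ, v ≠ 0 →
      0 < (star v ⬝ᵥ Y *ᵥ v).re ∧ 0 < (star v ⬝ᵥ (Y * W) *ᵥ v).re := by
  set T : Set (Matrix (Fin n) (Fin n) ℂ) :=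
    {Z | ∃ P Q : Matrix (Fin n) (Fin n) ℂ, P.PosSemidef ∧ Q.PosSemidef ∧
      P.trace + Q.trace = 1 ∧ P + W * Q = Z} with hT
  have hTc : IsCompact T := by
    have : T = (fun B : Matrix (Fin n) (Fin n) ℂ × Matrix (Fin n) (Fin n) ℂ =>
        B.1ᴴ * B.1 + W * (B.2ᴴ * B.2)) '' {B | (B.1ᴴ * B.1).trace + (B.2ᴴ * B.2).trace = 1} := by
      ext Z
      constructor
      · rintro ⟨P, Q, hP, hQ, htr, rfl⟩
        obtain ⟨B₁, rfl⟩ := CStarAlgebra.nonneg_iff_eq_star_mul_self.mp hP.nonneg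
        obtain ⟨B₂, rfl⟩ := CStarAlgebra.nonneg_iff_eq_star_mul_self.mp hQ.nonneg
        exact ⟨(B₁, B₂), htr, rfl⟩
      · rintro ⟨B, htr, rfl⟩
        exact ⟨_, _, posSemidef_conjTranspose_mul_self _, posSemidef_conjTranspose_mul_self _,
          htr, rfl⟩
    rw [this]
    exact isCompact_setOf_trace_add_trace_eq_one.image (by fun_prop)
  have hTconv : Convex ℝ T := by
    rintro _ ⟨P, Q, hP, hQ, htr, rfl⟩ _ ⟨P', Q', hP', hQ', htr', rfl⟩ a b ha hb hab
    refine ⟨a • P + b • P', a • Q + b • Q', (hP.smul ha).add (hP'.smul hb),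
      (hQ.smul ha).add (hQ'.smul hb), ?_, ?_⟩
    · calc _ = a • (P.trace + Q.trace) + b • (P'.trace + Q'.trace) := by
            simp only [trace_add, trace_smul, smul_add]; abel
        _ = 1 := by rw [htr, htr', ← add_smul, hab, one_smul]
    · simp only [mul_add, Matrix.mul_smul, smul_add]; abel
  have hT0 : (0 : Matrix (Fin n) (Fin n) ℂ) ∉ T := by
    rintro ⟨P, Q, hP, hQ, htr, h⟩
    have hQ0 := eq_zero_of_posSemidef_add_mul_eq_zero hW hP hQ h
    rw [hQ0, mul_zero, add_zero] at h
    simp [h, hQ0] at htr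
  have : LocallyConvexSpace ℝ (Matrix (Fin n) (Fin n) ℂ) :=
    inferInstanceAs (LocallyConvexSpace ℝ (Fin n → Fin n → ℂ))
  obtain ⟨f, u, hu, hf⟩ :=
    RCLike.geometric_hahn_banach_point_closed (𝕜 := ℂ) hTconv hTc.isClosed hT0
  obtain ⟨Y, hY⟩ := exists_forall_map_vecMulVec f.toLinearMap
  rw [map_zero, map_zero] at hu
  have scale : ∀ v : Fin n → ℂ, v ≠ 0 → ∃ c : ℝ, 0 < c ∧
      (c • vecMulVec v (star v)).trace = 1 ∧ (c • vecMulVec v (star v)).PosSemidef := by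
    intro v hv
    have h0 : 0 < v ⬝ᵥ star v := dotProduct_self_star_pos_iff.mpr hv
    obtain ⟨r, hr⟩ : ∃ r : ℝ, (r : ℂ) = v ⬝ᵥ star v :=
      ⟨(v ⬝ᵥ star v).re, Complex.ext rfl (by simpa using (Complex.lt_def.mp h0).2)⟩
    rw [← hr, Complex.zero_lt_real] at h0
    refine ⟨r⁻¹, by positivity, ?_, (posSemidef_vecMulVec_self_star v).smul (by positivity)⟩
    rw [trace_smul, trace_vecMulVec, ← hr, Complex.real_smul]
    norm_cast
    exact inv_mul_cancel₀ h0.ne'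
  have pos : ∀ (c : ℝ) (z : ℂ) (Z : Matrix (Fin n) (Fin n) ℂ), 0 < c → c • Z ∈ T →
      f Z = z → 0 < z.re := by
    rintro c _ Z hc hZ rfl
    have h1 := hu.trans (hf _ hZ)
    have h2 : f (c • Z) = c * f Z := by
      rw [← Complex.real_smul, ← map_real_smul f f.continuous]
    rw [h2] at h1
    simp only [RCLike.re_to_complex, Complex.re_ofReal_mul] at h1
    exact pos_of_mul_pos_right h1 hc.le
  refine ⟨Y, fun v hv => ?_⟩
  obtain ⟨c, hc, htr, hpsd⟩ := scale v hv
  refine ⟨pos c _ (vecMulVec v (star v)) hc ⟨_, 0, hpsd, .zero, by simpa using htr, by simp⟩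
    (hY v v), pos c _ (vecMulVec (W *ᵥ v) (star v)) hc ⟨0, _, .zero, hpsd, by simpa using htr, ?_⟩ ?_⟩
  · rw [Matrix.mul_smul, zero_add, mul_vecMulVec]
  · rw [← mulVec_mulVec]; exact hY _ _

/-! ### The kernel projection and the extension of multipliers -/

/-- `E` is the projection onto the kernel of `C` along the range of `C`. -/
structure IsKernelProjection (C E : Matrix (Fin n) (Fin n) ℂ) : Prop where
  idem : E * E = E
  mul_eq_zero : C * E = 0
  eq_zero_mul : E * C = 0
  apply_eq_self : ∀ v, C *ᵥ v = 0 → E *ᵥ v = v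

theorem IsSemisimpleEigenvalue.mulVec_eq_zero {C : Matrix (Fin n) (Fin n) ℂ}
    (h : IsSemisimpleEigenvalue C 0) {v : Fin n → ℂ} (hv : C *ᵥ (C *ᵥ v) = 0) : C *ᵥ v = 0 := by
  have hle : Module.End.eigenspace C.toLin' 0 ≤ Module.End.maxGenEigenspace C.toLin' 0 :=
    Module.End.eigenspace_le_maxGenEigenspace
  have heq := Submodule.eq_of_le_of_finrank_eq hle <| by
    rw [LinearMap.finrank_maxGenEigenspace_eq, Matrix.charpoly_toLin', h]
  have hmem : v ∈ Module.End.maxGenEigenspace C.toLin' 0 := by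
    rw [Module.End.mem_maxGenEigenspace]
    exact ⟨2, by simpa [pow_two] using hv⟩
  rw [← heq, Module.End.eigenspace_zero] at hmem
  simpa using hmem

theorem exists_isKernelProjection {C : Matrix (Fin n) (Fin n) ℂ}
    (h : Module.End.HasEigenvalue C.toLin' 0 → IsSemisimpleEigenvalue C 0) :
    ∃ E, IsKernelProjection C E := by
  have hsq : ∀ v : Fin n → ℂ, C *ᵥ (C *ᵥ v) = 0 → C *ᵥ v = 0 := fun v hv => by
    by_cases h0 : Module.End.HasEigenvalue C.toLin' 0
    · exact (h h0).mulVec_eq_zero hv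
    · have := ((LinearMap.not_hasEigenvalue_zero_tfae C.toLin').out 0 5).mp h0
      exact this _ (by simpa using hv)
  have hdisj : Disjoint (LinearMap.ker C.toLin') (LinearMap.range C.toLin') := by
    rw [Submodule.disjoint_def]
    rintro _ hx ⟨y, rfl⟩
    exact hsq y (by simpa using hx)
  have hcompl : IsCompl (LinearMap.ker C.toLin') (LinearMap.range C.toLin') :=
    (Submodule.isCompl_iff_disjoint _ _
      (by rw [add_comm, LinearMap.finrank_range_add_finrank_ker])).mpr hdisj
  set p := Submodule.projection _ _ hcompl
  have hpx : ∀ x, LinearMap.toMatrix' p *ᵥ x = p x := fun x => by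
    rw [← toLin'_apply, toLin'_toMatrix']
  have hpm : ∀ x, C *ᵥ p x = 0 := fun x => by
    have : p x ∈ LinearMap.ker C.toLin' := Submodule.projection_apply_mem hcompl x
    simpa using this
  have hpi : ∀ v, C *ᵥ v = 0 → p v = v := fun v hv =>
    Submodule.projection_apply_of_mem_left hcompl (by simpa using hv)
  refine ⟨LinearMap.toMatrix' p, ?_, ?_, ?_, fun v hv => ?_⟩
  · refine ext_of_mulVec_single fun i => ?_
    rw [← mulVec_mulVec, hpx, hpx, hpi _ (hpm _)]
  · refine ext_of_mulVec_single fun i => ?_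
    rw [← mulVec_mulVec, hpx, hpm, zero_mulVec]
  · refine ext_of_mulVec_single fun i => ?_
    rw [← mulVec_mulVec, hpx, zero_mulVec]
    exact Submodule.projection_apply_of_mem_right hcompl ⟨_, rfl⟩
  · rw [hpx, hpi v hv]

theorem det_add_smul_one_ne_zero {C : Matrix (Fin n) (Fin n) ℂ}
    (hC : ∀ τ : ℝ, 0 < τ → (1 + (τ : ℂ) • C).det ≠ 0) {t : ℝ} (ht : 0 < t) :
    (C + (t : ℂ) • 1).det ≠ 0 := by
  have ht' : (t : ℂ) ≠ 0 := by exact_mod_cast ht.ne'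
  have : C + (t : ℂ) • 1 = (t : ℂ) • (1 + ((t⁻¹ : ℝ) : ℂ) • C) := by
    rw [smul_add, smul_smul, Complex.ofReal_inv, mul_inv_cancel₀ ht', one_smul, add_comm]
  rw [this, det_smul]
  exact mul_ne_zero (pow_ne_zero _ ht') (hC _ (by positivity))

namespace IsKernelProjection

variable {C E : Matrix (Fin n) (Fin n) ℂ}

/-- Adding the kernel projection moves the eigenvalue `0` to `1`. -/
theorem det_add_ne_zero (hE : IsKernelProjection C E)
    (hC : ∀ τ : ℝ, 0 < τ → (1 + (τ : ℂ) • C).det ≠ 0) (t : ℝ) (ht : 0 ≤ t) :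
    (C + E + (t : ℂ) • 1).det ≠ 0 := by
  intro hdet
  obtain ⟨v, hv0, hv⟩ := exists_mulVec_eq_zero_iff.mpr hdet
  have hEv : E *ᵥ v = 0 := by
    have h1 : E *ᵥ ((C + E + (t : ℂ) • 1) *ᵥ v) = (1 + (t : ℂ)) • E *ᵥ v := by
      rw [mulVec_mulVec, mul_add, mul_add, hE.eq_zero_mul, hE.idem, zero_add, Matrix.mul_smul,
        mul_one, add_mulVec, smul_mulVec, add_smul, one_smul]
    rw [hv, mulVec_zero] at h1
    refine (smul_eq_zero.mp h1.symm).resolve_left ?_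
    exact_mod_cast (by positivity : (1 + t) ≠ 0)
  rw [add_mulVec, add_mulVec, hEv, add_zero] at hv
  rcases ht.eq_or_lt with rfl | ht
  · have : C *ᵥ v = 0 := by simpa using hv
    exact hv0 (by rw [← hE.apply_eq_self v this, hEv])
  · rw [← add_mulVec] at hv
    exact det_add_smul_one_ne_zero hC ht (exists_mulVec_eq_zero_iff.mp ⟨v, hv0, hv⟩)

/-- The kernel projection as a limit of resolvents. -/
theorem tendsto_smul_inv (hE : IsKernelProjection C E)
    (hC : ∀ τ : ℝ, 0 < τ → (1 + (τ : ℂ) • C).det ≠ 0) :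
    Tendsto (fun t : ℝ => (t : ℂ) • (C + (t : ℂ) • 1)⁻¹) (𝓝[>] 0) (𝓝 E) := by
  have h1 : ∀ t : ℝ, 0 < t → (t : ℂ) • (C + (t : ℂ) • 1)⁻¹ =
      E + (t : ℂ) • ((C + E + (t : ℂ) • 1)⁻¹ * (1 - E)) := by
    intro t ht
    have hd : IsUnit (C + (t : ℂ) • 1).det := (det_add_smul_one_ne_zero hC ht).isUnit
    have hd' : IsUnit (C + E + (t : ℂ) • 1).det := (hE.det_add_ne_zero hC t ht.le).isUnit
    -- off the kernel of `C`, the matrices `C + t` and `C + E + t` agree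
    have hcomm : (1 - E) * (C + (t : ℂ) • 1) = (C + E + (t : ℂ) • 1) * (1 - E) := by
      simp only [sub_mul, mul_add, add_mul, mul_sub, hE.idem, hE.mul_eq_zero, hE.eq_zero_mul,
        Matrix.mul_smul, Matrix.smul_mul, one_mul, mul_one]
      abel
    have key : (E + (t : ℂ) • ((C + E + (t : ℂ) • 1)⁻¹ * (1 - E))) * (C + (t : ℂ) • 1) =
        (t : ℂ) • 1 := by
      rw [add_mul, Matrix.smul_mul, mul_assoc, hcomm, nonsing_inv_mul_cancel_left _ _ hd', mul_add,
        hE.eq_zero_mul, zero_add, Matrix.mul_smul, mul_one, ← smul_add, add_sub_cancel]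
    rw [← mul_nonsing_inv_cancel_right (C + (t : ℂ) • 1)
      (E + (t : ℂ) • ((C + E + (t : ℂ) • 1)⁻¹ * (1 - E))) hd, key, Matrix.smul_mul, one_mul]
  have h2 : ContinuousAt (fun t : ℝ => E + (t : ℂ) • ((C + E + (t : ℂ) • 1)⁻¹ * (1 - E))) 0 := by
    simp only [inv_def, Ring.inverse_eq_inv']
    have : (C + E + ((0 : ℝ) : ℂ) • 1).det ≠ 0 := hE.det_add_ne_zero hC 0 le_rfl
    have h3 : ContinuousAt (fun t : ℝ => (C + E + (t : ℂ) • 1).det⁻¹) 0 :=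
      ContinuousAt.inv₀ (Continuous.continuousAt (by fun_prop)) this
    have h4 : Continuous (fun t : ℝ => (C + E + (t : ℂ) • 1).adjugate) :=
      Continuous.matrix_adjugate (by fun_prop)
    refine continuousAt_const.add (Complex.continuous_ofReal.continuousAt.smul ?_)
    exact ((h3.smul h4.continuousAt).mul continuousAt_const)
  have h5 := h2.tendsto.mono_left (nhdsWithin_le_nhds (s := Set.Ioi 0))
  simp only [Complex.ofReal_zero, zero_smul, add_zero] at h5
  refine h5.congr' ?_
  filter_upwards [self_mem_nhdsWithin] with t ht using (h1 t ht).symm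

end IsKernelProjection

/-- Extension of a strict multiplier for the regularisation `C + E` to a multiplier for `C`. -/
def extendMultiplier (E Y : Matrix (Fin n) (Fin n) ℂ) : Matrix (Fin n) (Fin n) ℂ :=
  Eᴴ * E + (1 - E)ᴴ * Y * (1 - E)

theorem star_dotProduct_conj_mulVec (S M : Matrix (Fin n) (Fin n) ℂ) (v : Fin n → ℂ) :
    star v ⬝ᵥ (Sᴴ * M * S) *ᵥ v = star (S *ᵥ v) ⬝ᵥ M *ᵥ (S *ᵥ v) := by
  rw [mul_assoc, ← mulVec_mulVec, ← mulVec_mulVec, dotProduct_mulVec, star_mulVec]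

/-- `Y` is strictly accretive and `Y C` is accretive. For `C = A B`, such a `Y` yields the separating
multiplier `H = A* Y*` of the pair `A, B`. -/
def IsMultiplier (C Y : Matrix (Fin n) (Fin n) ℂ) : Prop :=
  (∀ v : Fin n → ℂ, v ≠ 0 → 0 < (star v ⬝ᵥ Y *ᵥ v).re) ∧
    ∀ v : Fin n → ℂ, 0 ≤ (star v ⬝ᵥ (Y * C) *ᵥ v).re

theorem IsKernelProjection.isMultiplier_extendMultiplier {C E Y : Matrix (Fin n) (Fin n) ℂ}
    (hE : IsKernelProjection C E)
    (hY : ∀ v : Fin n → ℂ, v ≠ 0 →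
      0 < (star v ⬝ᵥ Y *ᵥ v).re ∧ 0 < (star v ⬝ᵥ (Y * (C + E)) *ᵥ v).re) :
    IsMultiplier C (extendMultiplier E Y) := by
  have nonneg : ∀ M : Matrix (Fin n) (Fin n) ℂ,
      (∀ v : Fin n → ℂ, v ≠ 0 → 0 < (star v ⬝ᵥ M *ᵥ v).re) →
      ∀ v : Fin n → ℂ, 0 ≤ (star v ⬝ᵥ M *ᵥ v).re := fun M hM v => by
    rcases eq_or_ne v 0 with rfl | hv
    · simp
    · exact (hM v hv).le
  constructor
  · intro v hv
    have h1 : star v ⬝ᵥ extendMultiplier E Y *ᵥ v = star (E *ᵥ v) ⬝ᵥ (E *ᵥ v) +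
        star ((1 - E) *ᵥ v) ⬝ᵥ Y *ᵥ ((1 - E) *ᵥ v) := by
      have := star_dotProduct_conj_mulVec E 1 v
      rw [mul_one, one_mulVec] at this
      rw [extendMultiplier, add_mulVec, dotProduct_add, star_dotProduct_conj_mulVec, this]
    rw [h1, Complex.add_re]
    by_cases h0 : E *ᵥ v = 0
    · have hw : (1 - E) *ᵥ v = v := by rw [sub_mulVec, h0, one_mulVec, sub_zero]
      rw [h0, hw]
      simpa using (hY v hv).1
    · have h2 : 0 < (star (E *ᵥ v) ⬝ᵥ (E *ᵥ v)).re :=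
        (Complex.lt_def.mp (dotProduct_star_self_pos_iff.mpr h0)).1
      have := nonneg Y (fun v hv => (hY v hv).1) ((1 - E) *ᵥ v)
      linarith
  · intro v
    have h1 : extendMultiplier E Y * C = (1 - E)ᴴ * (Y * (C + E)) * (1 - E) := by
      have h2 : (1 - E) * C = (C + E) * (1 - E) := by
        simp only [sub_mul, add_mul, mul_sub, hE.idem, hE.mul_eq_zero, hE.eq_zero_mul,
          one_mul, mul_one]
        abel
      rw [extendMultiplier, add_mul, mul_assoc Eᴴ, hE.eq_zero_mul, mul_zero, zero_add,
        mul_assoc _ (1 - E) C, h2]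
      simp only [mul_assoc]
    rw [h1, star_dotProduct_conj_mulVec]
    exact nonneg _ (fun v hv => (hY v hv).2) _

/-- A nonzero vector is a positive multiple of a unit vector (in the sup norm). -/
theorem exists_unit_smul {v : Fin n → ℂ} (hv : v ≠ 0) :
    ∃ c : ℝ, 0 < c ∧ ∃ u ∈ Metric.sphere (0 : Fin n → ℂ) 1, v = (c : ℂ) • u := by
  have h : (‖v‖ : ℂ) ≠ 0 := by exact_mod_cast norm_ne_zero_iff.mpr hv
  refine ⟨‖v‖, norm_pos_iff.mpr hv, (‖v‖ : ℂ)⁻¹ • v, ?_, ?_⟩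
  · rw [mem_sphere_zero_iff_norm, norm_smul, norm_inv, Complex.norm_real, norm_norm,
      inv_mul_cancel₀ (norm_ne_zero_iff.mpr hv)]
  · rw [smul_smul, mul_inv_cancel₀ h, one_smul]

theorem re_star_smul_dotProduct_mulVec_smul (M : Matrix (Fin n) (Fin n) ℂ) (c : ℝ)
    (u : Fin n → ℂ) :
    (star ((c : ℂ) • u) ⬝ᵥ M *ᵥ ((c : ℂ) • u)).re = c ^ 2 * (star u ⬝ᵥ M *ᵥ u).re := by
  have : star ((c : ℂ) • u) ⬝ᵥ M *ᵥ ((c : ℂ) • u) = ((c ^ 2 : ℝ) : ℂ) * (star u ⬝ᵥ M *ᵥ u) := by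
    rw [star_smul, mulVec_smul, smul_dotProduct, dotProduct_smul]
    simp
    ring
  rw [this, Complex.re_ofReal_mul]

theorem forall_ne_zero_re_pos_iff {M : Matrix (Fin n) (Fin n) ℂ} :
    (∀ v : Fin n → ℂ, v ≠ 0 → 0 < (star v ⬝ᵥ M *ᵥ v).re) ↔
      ∀ u ∈ Metric.sphere (0 : Fin n → ℂ) 1, 0 < (star u ⬝ᵥ M *ᵥ u).re := by
  constructor
  · rintro h u hu
    exact h u (norm_ne_zero_iff.mp (by rw [mem_sphere_zero_iff_norm.mp hu]; exact one_ne_zero))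
  · intro h v hv
    obtain ⟨c, hc, u, hu, rfl⟩ := exists_unit_smul hv
    rw [re_star_smul_dotProduct_mulVec_smul]
    have := h u hu
    positivity

theorem isOpen_setOf_re_pos :
    IsOpen {M : Matrix (Fin n) (Fin n) ℂ |
      ∀ v : Fin n → ℂ, v ≠ 0 → 0 < (star v ⬝ᵥ M *ᵥ v).re} := by
  simp only [forall_ne_zero_re_pos_iff]
  have hc : IsClosed {p : Matrix (Fin n) (Fin n) ℂ × Metric.sphere (0 : Fin n → ℂ) 1 |
      (star p.2.1 ⬝ᵥ p.1 *ᵥ p.2.1).re ≤ 0} := isClosed_le (by fun_prop) continuous_const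
  rw [← isClosed_compl_iff]
  convert isClosedMap_fst_of_compactSpace _ hc using 1
  ext M
  simp

theorem exists_pos_mul_le_re {M : Matrix (Fin n) (Fin n) ℂ}
    (hM : ∀ v : Fin n → ℂ, v ≠ 0 → 0 < (star v ⬝ᵥ M *ᵥ v).re) :
    ∃ ε : ℝ, 0 < ε ∧ ∀ v : Fin n → ℂ, 0 ≤ (star v ⬝ᵥ (M - (ε : ℂ) • 1) *ᵥ v).re := by
  have hcont : Continuous fun ε : ℝ => M - (ε : ℂ) • (1 : Matrix (Fin n) (Fin n) ℂ) := by fun_prop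
  have hmem := (isOpen_setOf_re_pos.preimage hcont).mem_nhds (x := 0) (by simpa using hM)
  obtain ⟨ε, hε, h⟩ := nonempty_of_mem
    (inter_mem (mem_nhdsWithin_of_mem_nhds hmem) (self_mem_nhdsWithin (s := Set.Ioi (0 : ℝ))))
  refine ⟨ε, h, fun v => ?_⟩
  rcases eq_or_ne v 0 with rfl | hv
  · simp
  · exact (hε v hv).le

theorem exists_quadSeparates {A B Y : Matrix (Fin n) (Fin n) ℂ}
    (h1 : ∀ v : Fin n → ℂ, v ≠ 0 → 0 < (star v ⬝ᵥ Y *ᵥ v).re)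
    (h2 : ∀ v : Fin n → ℂ, 0 ≤ (star v ⬝ᵥ (Y * (A * B)) *ᵥ v).re) :
    ∃ ε : ℝ, 0 < ε ∧ QuadSeparates A B (phaseMultiplier (Aᴴ * Yᴴ)) ε := by
  obtain ⟨ε, hε, h⟩ := exists_pos_mul_le_re h1
  refine ⟨2 * ε, by positivity, quadSeparates_iff.mpr ⟨?_, ?_⟩⟩
  · have e : Aᴴ * Yᴴ * A + (Aᴴ * Yᴴ * A)ᴴ - ((2 * ε : ℝ) : ℂ) • (Aᴴ * A) =
        Aᴴ * ((Y - (ε : ℂ) • 1) + (Y - (ε : ℂ) • 1)ᴴ) * A := by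
      have : ((2 * ε : ℝ) : ℂ) = ε + ε := by push_cast; ring
      rw [this]
      simp [conjTranspose_mul, mul_add, add_mul, mul_sub, sub_mul, add_smul, mul_assoc]
      abel
    rw [e]
    exact (posSemidef_add_conjTranspose_iff.mpr h).conjTranspose_mul_mul_same A
  · have e : (Aᴴ * Yᴴ)ᴴ * B = Y * (A * B) := by simp [conjTranspose_mul, mul_assoc]
    rw [e]
    exact posSemidef_add_conjTranspose_iff.mpr h2

/-! ### The ring of proper stable functions -/

/-- The closed right half-plane. -/
abbrev RHP : Type := {s : ℂ // 0 ≤ s.re}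

theorem intDegree_nonpos_iff {r : RatFunc ℝ} :
    r.intDegree ≤ 0 ↔ r.num.natDegree ≤ r.denom.natDegree := by
  rw [RatFunc.intDegree]; omega

theorem isProperStable_iff {r : RatFunc ℝ} :
    IsProperStable r ↔ r.intDegree ≤ 0 ∧ ∀ s : RHP, r.denom.eval₂ (algebraMap ℝ ℂ) s ≠ 0 := by
  rw [IsProperStable, intDegree_nonpos_iff]
  exact and_congr_right fun _ => ⟨fun h s => h s s.2, fun h s hs => h ⟨s, hs⟩⟩

theorem eval₂_ne_zero_of_dvd {p q : Polynomial ℝ} (h : p ∣ q) {s : ℂ}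
    (hq : q.eval₂ (algebraMap ℝ ℂ) s ≠ 0) : p.eval₂ (algebraMap ℝ ℂ) s ≠ 0 := by
  obtain ⟨c, rfl⟩ := h
  rw [Polynomial.eval₂_mul] at hq
  exact left_ne_zero_of_mul hq

namespace IsProperStable

theorem const (c : ℝ) : IsProperStable (RatFunc.C c) := by
  rw [isProperStable_iff]; simp

theorem add {x y : RatFunc ℝ} (hx : IsProperStable x) (hy : IsProperStable y) :
    IsProperStable (x + y) := by
  rw [isProperStable_iff] at *
  refine ⟨?_, fun s => eval₂_ne_zero_of_dvd (RatFunc.denom_add_dvd x y) ?_⟩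
  · by_cases h0 : y = 0
    · simpa [h0] using hx.1
    by_cases h1 : x + y = 0
    · simp [h1]
    exact (RatFunc.intDegree_add_le h0 h1).trans (max_le hx.1 hy.1)
  · rw [Polynomial.eval₂_mul]
    exact mul_ne_zero (hx.2 s) (hy.2 s)

theorem mul {x y : RatFunc ℝ} (hx : IsProperStable x) (hy : IsProperStable y) :
    IsProperStable (x * y) := by
  rw [isProperStable_iff] at *
  refine ⟨?_, fun s => eval₂_ne_zero_of_dvd (RatFunc.denom_mul_dvd x y) ?_⟩
  · by_cases h0 : x = 0
    · simp [h0]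
    by_cases h1 : y = 0
    · simp [h1]
    rw [RatFunc.intDegree_mul h0 h1]
    linarith [hx.1, hy.1]
  · rw [Polynomial.eval₂_mul]
    exact mul_ne_zero (hx.2 s) (hy.2 s)

end IsProperStable

/-- The ring `RH∞` of proper stable real-rational functions. -/
def properStable : Subring (RatFunc ℝ) where
  carrier := {r | IsProperStable r}
  mul_mem' := IsProperStable.mul
  one_mem' := by simpa using IsProperStable.const 1
  add_mem' := IsProperStable.add
  zero_mem' := by simpa using IsProperStable.const 0
  neg_mem' {x} hx := by simpa using (IsProperStable.const (-1)).mul hx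

/-- Substituting `1 / s`, the quotient `p / q` of polynomials with `deg p ≤ deg q` becomes a quotient
of polynomials regular at `0`. -/
theorem tendsto_eval_cobounded {r : RatFunc ℝ} (hr : r.num.natDegree ≤ r.denom.natDegree) :
    Tendsto (fun s : ℂ => RatFunc.eval (algebraMap ℝ ℂ) s r) (Bornology.cobounded ℂ)
      (𝓝 (valueAtInfty r)) := by
  set N := r.denom.natDegree
  set p := r.num.reflect N
  set q := r.denom.reflect N
  have hev : ∀ (f : Polynomial ℝ), ContinuousAt (fun z : ℂ => f.eval₂ (algebraMap ℝ ℂ) z) 0 :=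
    fun f => (Polynomial.continuous_eval₂ f _).continuousAt
  have hval : ∀ f : Polynomial ℝ, (f.reflect N).eval₂ (algebraMap ℝ ℂ) 0 = f.coeff N := fun f => by
    rw [Polynomial.eval₂_at_zero, Polynomial.coeff_reflect, Polynomial.revAt_zero]
    rfl
  have hq0 : q.eval₂ (algebraMap ℝ ℂ) 0 ≠ 0 := by
    rw [hval, Complex.ofReal_ne_zero]
    exact Polynomial.leadingCoeff_ne_zero.mpr r.denom_ne_zero
  have hlim : ContinuousAt
      (fun z : ℂ => p.eval₂ (algebraMap ℝ ℂ) z / q.eval₂ (algebraMap ℝ ℂ) z) 0 :=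
    (hev p).div (hev q) hq0
  have h := hlim.tendsto.comp (tendsto_inv₀_cobounded (α := ℂ))
  have hv : p.eval₂ (algebraMap ℝ ℂ) 0 / q.eval₂ (algebraMap ℝ ℂ) 0 = valueAtInfty r := by
    rw [hval, hval, valueAtInfty, Polynomial.leadingCoeff]
    push_cast
    rfl
  rw [hv] at h
  refine h.congr' ?_
  filter_upwards [Bornology.eventually_ne_cobounded (0 : ℂ)] with s hs
  let := invertibleOfNonzero hs
  have h1 := Polynomial.eval₂_reflect_mul_pow (algebraMap ℝ ℂ) s N r.num hr
  have h2 := Polynomial.eval₂_reflect_mul_pow (algebraMap ℝ ℂ) s N r.denom le_rfl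
  rw [invOf_eq_inv] at h1 h2
  rw [Function.comp_apply, RatFunc.eval, ← h1, ← h2, mul_div_mul_right _ _ (pow_ne_zero _ hs)]

/-- The closed right half-plane is unbounded. -/
theorem cobounded_inf_rhp_neBot :
    (comap ((↑) : RHP → ℂ) (Bornology.cobounded ℂ)).NeBot := by
  rw [comap_neBot_iff_frequently]
  have h : Tendsto (fun x : ℝ => (x : ℂ)) atTop (Bornology.cobounded ℂ) := by
    rw [← tendsto_norm_atTop_iff_cobounded]
    simpa using tendsto_abs_atTop_atTop
  refine h.frequently (Eventually.frequently ?_)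
  filter_upwards [eventually_ge_atTop 0] with x hx using ⟨⟨x, by simpa using hx⟩, rfl⟩

/-- The value of a rational function at a point of the closed right half-plane, or at infinity. -/
def valueAt (r : RatFunc ℝ) : OnePoint RHP → ℂ
  | none => valueAtInfty r
  | some s => RatFunc.eval (algebraMap ℝ ℂ) s r

theorem coclosedCompact_rhp :
    coclosedCompact RHP = comap ((↑) : RHP → ℂ) (Bornology.cobounded ℂ) := by
  rw [Metric.cobounded_eq_cocompact, coclosedCompact_eq_cocompact]
  have : IsClosed {s : ℂ | 0 ≤ s.re} := isClosed_le continuous_const Complex.continuous_re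
  exact le_antisymm this.isClosedEmbedding_subtypeVal.tendsto_cocompact.le_comap
    (comap_cocompact_le continuous_subtype_val)

theorem IsProperStable.eval_differentiableAt {r : RatFunc ℝ} (hr : IsProperStable r) {s : ℂ}
    (hs : 0 ≤ s.re) : DifferentiableAt ℂ (fun s => RatFunc.eval (algebraMap ℝ ℂ) s r) s := by
  have h : ∀ f : Polynomial ℝ, DifferentiableAt ℂ (fun z : ℂ => f.eval₂ (algebraMap ℝ ℂ) z) s :=
    fun f => by simpa [Polynomial.eval₂_eq_eval_map] using
      (f.map (algebraMap ℝ ℂ)).differentiable.differentiableAt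
  exact (h _).div (h _) (hr.2 s hs)

theorem IsProperStable.continuous_valueAt {r : RatFunc ℝ} (hr : IsProperStable r) :
    Continuous (valueAt r) := by
  rw [OnePoint.continuous_iff]
  constructor
  · rw [coclosedCompact_rhp]
    exact (tendsto_eval_cobounded hr.1).comp tendsto_comap
  · rw [continuous_iff_continuousAt]
    intro s
    exact (hr.eval_differentiableAt s.2).continuousAt.comp continuousAt_subtype_val

theorem IsProperStable.tendsto_valueAtInfty {r : RatFunc ℝ} (hr : IsProperStable r) :
    Tendsto (fun s : RHP => RatFunc.eval (algebraMap ℝ ℂ) s r)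
      (comap ((↑) : RHP → ℂ) (Bornology.cobounded ℂ)) (𝓝 (valueAtInfty r)) :=
  (tendsto_eval_cobounded hr.1).comp tendsto_comap

/-- Evaluation of proper stable functions at a point of the compactified closed right half-plane.
At infinity the ring operations are respected because the value there is a limit. -/
def evalHom (x : OnePoint RHP) : properStable →+* ℂ where
  toFun r := valueAt r x
  map_one' := by
    cases x with
    | infty => simp [valueAt, valueAtInfty]
    | coe s => simp [valueAt]
  map_zero' := by
    cases x with
    | infty => simp [valueAt, valueAtInfty]
    | coe s => simp [valueAt]
  map_add' a b := by
    have hs : ∀ s : RHP, RatFunc.eval (algebraMap ℝ ℂ) s (a + b : RatFunc ℝ) =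
        RatFunc.eval (algebraMap ℝ ℂ) s a.1 + RatFunc.eval (algebraMap ℝ ℂ) s b.1 :=
      fun s => RatFunc.eval_add _ _ (a.2.2 s s.2) (b.2.2 s s.2)
    cases x with
    | infty =>
      have := cobounded_inf_rhp_neBot
      refine tendsto_nhds_unique (IsProperStable.tendsto_valueAtInfty (a + b).2) ?_
      exact ((IsProperStable.tendsto_valueAtInfty a.2).add
        (IsProperStable.tendsto_valueAtInfty b.2)).congr fun s => (hs s).symm
    | coe s => exact hs s
  map_mul' a b := by
    have hs : ∀ s : RHP, RatFunc.eval (algebraMap ℝ ℂ) s (a * b : RatFunc ℝ) =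
        RatFunc.eval (algebraMap ℝ ℂ) s a.1 * RatFunc.eval (algebraMap ℝ ℂ) s b.1 :=
      fun s => RatFunc.eval_mul _ _ (a.2.2 s s.2) (b.2.2 s s.2)
    cases x with
    | infty =>
      have := cobounded_inf_rhp_neBot
      refine tendsto_nhds_unique (IsProperStable.tendsto_valueAtInfty (a * b).2) ?_
      exact ((IsProperStable.tendsto_valueAtInfty a.2).mul
        (IsProperStable.tendsto_valueAtInfty b.2)).congr fun s => (hs s).symm
    | coe s => exact hs s

theorem continuous_evalHom (r : properStable) : Continuous fun x => evalHom x r :=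
  IsProperStable.continuous_valueAt r.2

/-- A proper stable function without zeros in the closed right half-plane or at infinity is a unit
of the ring of proper stable functions. -/
theorem isUnit_of_evalHom_ne_zero {r : properStable} (h : ∀ x, evalHom x r ≠ 0) : IsUnit r := by
  have h0 : (r : RatFunc ℝ) ≠ 0 := fun h0 => h OnePoint.infty (by
    rw [show r = 0 from Subtype.ext h0, map_zero])
  have hdeg : r.1.denom.natDegree ≤ r.1.num.natDegree := by
    by_contra! hlt
    refine h OnePoint.infty ?_
    change valueAtInfty r.1 = 0
    rw [valueAtInfty, Polynomial.coeff_eq_zero_of_natDegree_lt hlt, zero_div, Complex.ofReal_zero]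
  have hinv : IsProperStable (r : RatFunc ℝ)⁻¹ := by
    rw [isProperStable_iff]
    constructor
    · rw [RatFunc.intDegree_inv, RatFunc.intDegree]
      omega
    · intro s
      refine eval₂_ne_zero_of_dvd (RatFunc.denom_inv_dvd h0) fun hz => h (s : OnePoint RHP) ?_
      change RatFunc.eval (algebraMap ℝ ℂ) s r.1 = 0
      rw [RatFunc.eval, hz, zero_div]
  exact IsUnit.of_mul_eq_one ⟨_, hinv⟩ (Subtype.ext (mul_inv_cancel₀ h0))

/-- The inclusion of the extended imaginary axis in the compactified closed right half-plane. -/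
def imagAxis : OnePoint ℝ → OnePoint RHP :=
  OnePoint.map fun ω : ℝ => ⟨(ω : ℂ) * Complex.I, by simp⟩

theorem continuous_imagAxis : Continuous imagAxis := by
  refine OnePoint.continuous_map (by fun_prop) ?_
  rw [coclosedCompact_rhp, tendsto_comap_iff, coclosedCompact_eq_cocompact,
    ← Metric.cobounded_eq_cocompact, ← tendsto_norm_atTop_iff_cobounded]
  refine (tendsto_norm_cobounded_atTop (E := ℝ)).congr fun ω => ?_
  simp

/-- The maximum principle: a proper stable function is bounded by its bound on the extended imaginary
axis. -/
theorem norm_evalHom_le {r : properStable} {c : ℝ} (h : ∀ ω, ‖evalHom (imagAxis ω) r‖ ≤ c)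
    (x : OnePoint RHP) : ‖evalHom x r‖ ≤ c := by
  cases x with
  | infty => exact h OnePoint.infty
  | coe s =>
    have hlim := tendsto_eval_cobounded (r := r.1) r.2.1
    refine PhragmenLindelof.right_half_plane_of_bounded_on_real
      (f := fun s => RatFunc.eval (algebraMap ℝ ℂ) s r.1) ?_ ⟨1, by norm_num, 0, ?_⟩ ?_
      (fun ω => h (ω : OnePoint ℝ)) s.2
    · refine DifferentiableOn.diffContOnCl fun z hz => ?_
      refine (IsProperStable.eval_differentiableAt r.2 ?_).differentiableWithinAt
      rw [Complex.closure_setOfPred_lt_re] at hz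
      exact hz
    · simpa using (hlim.isBigO_one ℝ).mono inf_le_left
    · have hre : Tendsto (fun x : ℝ => (x : ℂ)) atTop (Bornology.cobounded ℂ) := by
        rw [← tendsto_norm_atTop_iff_cobounded]
        simpa using tendsto_abs_atTop_atTop
      exact (hlim.comp hre).norm.isBoundedUnder_le

/-! ### Stability for all gains as a frequency condition -/

/-- A transfer matrix in `RH∞`, viewed as a matrix over the ring of proper stable functions. -/
def IsRHInf.lift {G : Matrix (Fin n) (Fin n) (RatFunc ℝ)} (hG : IsRHInf G) :
    Matrix (Fin n) (Fin n) properStable :=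
  of fun i j => ⟨G i j, hG i j⟩

theorem IsRHInf.map_lift {G : Matrix (Fin n) (Fin n) (RatFunc ℝ)} (hG : IsRHInf G) :
    hG.lift.map properStable.subtype = G := rfl

theorem IsRHInf.freqResponse_eq {G : Matrix (Fin n) (Fin n) (RatFunc ℝ)} (hG : IsRHInf G)
    (ω : OnePoint ℝ) : freqResponse G ω = hG.lift.map (evalHom (imagAxis ω)) := by
  cases ω <;> rfl

theorem IsRHInf.continuous_freqResponse {G : Matrix (Fin n) (Fin n) (RatFunc ℝ)}
    (hG : IsRHInf G) : Continuous (freqResponse G) := by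
  simp only [funext hG.freqResponse_eq]
  exact continuous_matrix fun i j => (continuous_evalHom _).comp continuous_imagAxis

theorem map_properStable_injective :
    Function.Injective fun M : Matrix (Fin n) (Fin n) properStable =>
      M.map properStable.subtype :=
  Matrix.map_injective Subtype.val_injective

/-- A square matrix over `RH∞` has an inverse over `RH∞` if and only if it is nonsingular at every
point of the compactified closed right half-plane. -/
theorem isUnit_and_isRHInf_inv_iff {M : Matrix (Fin n) (Fin n) properStable} :
    (IsUnit (M.map properStable.subtype) ∧ IsRHInf (M.map properStable.subtype)⁻¹) ↔
      ∀ x, evalHom x M.det ≠ 0 := by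
  constructor
  · rintro ⟨hu, hi⟩ x
    have h1 : M * hi.lift = 1 := by
      refine map_properStable_injective ?_
      simp only [Matrix.map_mul, hi.map_lift]
      rw [mul_nonsing_inv _ ((isUnit_iff_isUnit_det _).mp hu)]
      simp
    have h2 : M.det * hi.lift.det = 1 := by rw [← det_mul, h1, det_one]
    intro h0
    have := congrArg (evalHom x) h2
    simp [h0] at this
  · intro h
    have hd : IsUnit M.det := isUnit_of_evalHom_ne_zero h
    have h1 : M.map properStable.subtype * M⁻¹.map properStable.subtype = 1 := by
      rw [← Matrix.map_mul, mul_nonsing_inv _ hd]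
      simp
    refine ⟨IsUnit.of_mul_eq_one _ h1, ?_⟩
    rw [inv_eq_right_inv h1]
    exact fun i j => (M⁻¹ i j).2

/-- The scalar `τ` as a proper stable function. -/
def constant (τ : ℝ) : properStable := ⟨RatFunc.C τ, .const τ⟩

theorem evalHom_constant (x : OnePoint RHP) (τ : ℝ) : evalHom x (constant τ) = τ := by
  cases x with
  | infty =>
    change valueAtInfty (RatFunc.C τ) = _
    simp [valueAtInfty]
  | coe s =>
    change RatFunc.eval _ _ (RatFunc.C τ) = _
    simp

/-- The return difference determinant `det (1 + τ M)`. -/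
def returnDet (M : Matrix (Fin n) (Fin n) properStable) (τ : ℝ) : properStable :=
  (1 + constant τ • M).det

theorem evalHom_returnDet (M : Matrix (Fin n) (Fin n) properStable) (τ : ℝ) (x : OnePoint RHP) :
    evalHom x (returnDet M τ) = (1 + (τ : ℂ) • M.map (evalHom x)).det := by
  rw [returnDet, RingHom.map_det, RingHom.mapMatrix_apply]
  congr 1
  ext i j
  simp [Matrix.one_apply, evalHom_constant, apply_ite (evalHom x)]

theorem continuous_evalHom_returnDet (M : Matrix (Fin n) (Fin n) properStable) :
    Continuous fun p : ℝ × OnePoint RHP => evalHom p.2 (returnDet M p.1) := by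
  simp only [evalHom_returnDet]
  have : Continuous fun p : ℝ × OnePoint RHP => M.map (evalHom p.2) :=
    continuous_matrix fun i j => (continuous_evalHom _).comp continuous_snd
  fun_prop

/-- If `det (1 + τ M)` has no zero on the extended imaginary axis for any `τ > 0`, it has no zero in
the closed right half-plane either. By continuity in `τ`, starting from `τ = 0`: as long as there are
no zeros, the maximum principle for `1 / det (1 + τ M)` bounds `|det (1 + τ M)|` below by its minimum
over the imaginary axis, which is uniform for bounded `τ`. -/
theorem evalHom_returnDet_ne_zero {M : Matrix (Fin n) (Fin n) properStable}
    (h : ∀ τ : ℝ, 0 < τ → ∀ ω, evalHom (imagAxis ω) (returnDet M τ) ≠ 0) {τ : ℝ} (hτ : 0 < τ)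
    (x : OnePoint RHP) : evalHom x (returnDet M τ) ≠ 0 := by
  have h0 : ∀ x, evalHom x (returnDet M 0) = 1 := fun x => by simp [evalHom_returnDet]
  have hcont := continuous_evalHom_returnDet M
  obtain ⟨m, hm, hmin⟩ : ∃ m : ℝ, 0 < m ∧ ∀ t ∈ Set.Icc 0 τ, ∀ ω,
      m ≤ ‖evalHom (imagAxis ω) (returnDet M t)‖ := by
    have hc : Continuous fun p : ℝ × OnePoint ℝ => ‖evalHom (imagAxis p.2) (returnDet M p.1)‖ :=
      (hcont.comp (continuous_fst.prodMk (continuous_imagAxis.comp continuous_snd))).norm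
    obtain ⟨p, hp, hpmin⟩ := ((isCompact_Icc (a := (0 : ℝ)) (b := τ)).prod
      (isCompact_univ (X := OnePoint ℝ))).exists_isMinOn
      ⟨(0, OnePoint.infty), by simp [hτ.le]⟩ hc.continuousOn
    refine ⟨_, norm_pos_iff.mpr ?_, fun t ht ω => hpmin (a := (t, ω)) ⟨ht, trivial⟩⟩
    rcases hp.1.1.eq_or_lt with h1 | h1
    · rw [← h1, h0]; exact one_ne_zero
    · exact h _ h1 _
  set T : Set ℝ := {t | ∀ x, evalHom x (returnDet M t) ≠ 0} with hT
  have hTopen : IsOpen T := by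
    rw [← isClosed_compl_iff]
    have hz : IsClosed {p : ℝ × OnePoint RHP | evalHom p.2 (returnDet M p.1) = 0} :=
      isClosed_eq hcont continuous_const
    convert isClosedMap_fst_of_compactSpace _ hz using 1
    ext t
    simp [hT]
  have hTlow : ∀ t ∈ T ∩ Set.Icc 0 τ, ∀ x, m ≤ ‖evalHom x (returnDet M t)‖ := by
    rintro t ⟨htT, ht⟩ x
    obtain ⟨u, hu⟩ := isUnit_of_evalHom_ne_zero htT
    have hinv : ∀ x, evalHom x (u⁻¹ : properStableˣ) = (evalHom x (returnDet M t))⁻¹ := fun x => by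
      refine eq_inv_of_mul_eq_one_left ?_
      rw [← hu, ← map_mul, Units.inv_mul, map_one]
    have := norm_evalHom_le (r := (u⁻¹ : properStableˣ)) (c := m⁻¹) (fun ω => by
      rw [hinv, norm_inv]
      exact inv_anti₀ hm (hmin t ht ω)) x
    rw [hinv, norm_inv] at this
    exact (inv_le_inv₀ (norm_pos_iff.mpr (htT x)) hm).mp this
  have hTclosed : IsClosed (T ∩ Set.Icc 0 τ) := by
    have : T ∩ Set.Icc 0 τ =
        (⋂ x, {t : ℝ | m ≤ ‖evalHom x (returnDet M t)‖}) ∩ Set.Icc 0 τ := by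
      ext t
      refine ⟨fun ht => ⟨Set.mem_iInter.mpr (hTlow t ht), ht.2⟩, fun ht => ⟨fun x => ?_, ht.2⟩⟩
      exact norm_pos_iff.mp (hm.trans_le (Set.mem_iInter.mp ht.1 x))
    rw [this]
    refine (isClosed_iInter fun x => isClosed_le continuous_const ?_).inter isClosed_Icc
    exact (hcont.comp (continuous_id.prodMk continuous_const)).norm
  exact hTclosed.Icc_subset_of_forall_mem_nhdsWithin (fun x => by rw [h0]; exact one_ne_zero)
    (fun t ht => mem_nhdsWithin_of_mem_nhds (hTopen.mem_nhds ht.1)) ⟨hτ.le, le_rfl⟩ x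

/-- Coefficients are real, so the responses at `ω` and `-ω` are conjugate. -/
theorem evalHom_imagAxis_neg (ω : ℝ) (r : properStable) :
    evalHom (imagAxis ((-ω : ℝ) : OnePoint ℝ)) r =
      starRingEnd ℂ (evalHom (imagAxis (ω : OnePoint ℝ)) r) := by
  have h : ∀ p : Polynomial ℝ, p.eval₂ (algebraMap ℝ ℂ) (((-ω : ℝ) : ℂ) * Complex.I) =
      starRingEnd ℂ (p.eval₂ (algebraMap ℝ ℂ) ((ω : ℂ) * Complex.I)) := fun p => by
    rw [Polynomial.hom_eval₂]
    congr 1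
    · ext x; simp
    · simp
  change RatFunc.eval _ _ r.1 = starRingEnd ℂ (RatFunc.eval _ _ r.1)
  rw [RatFunc.eval, RatFunc.eval, map_div₀]
  exact congrArg₂ (· / ·) (h _) (h _)

theorem evalHom_imagAxis_ne_zero {r : properStable}
    (h : ∀ ω ∈ nonnegFreq, evalHom (imagAxis ω) r ≠ 0) (ω : OnePoint ℝ) :
    evalHom (imagAxis ω) r ≠ 0 := by
  cases ω with
  | infty => exact h _ (Set.mem_insert _ _)
  | coe ω =>
    rcases le_total 0 ω with hω | hω
    · exact h _ (Set.mem_insert_of_mem _ ⟨ω, hω, rfl⟩)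
    · have := h ((-ω : ℝ) : OnePoint ℝ) (Set.mem_insert_of_mem _ ⟨-ω, by simpa using hω, rfl⟩)
      rw [evalHom_imagAxis_neg] at this
      exact fun h0 => this (by rw [h0, map_zero])

/-- Robust stability for all gains `τ > 0` is a condition on the frequency response only. -/
theorem stability_iff_forall_freq {G K : Matrix (Fin n) (Fin n) (RatFunc ℝ)} (hG : IsRHInf G)
    (hK : IsRHInf K) :
    (∀ τ : ℝ, 0 < τ → IsUnit (1 + RatFunc.C τ • (G * K)) ∧
        IsRHInf (1 + RatFunc.C τ • (G * K))⁻¹) ↔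
      ∀ ω ∈ nonnegFreq, ∀ τ : ℝ, 0 < τ →
        (1 + (τ : ℂ) • (freqResponse G ω * freqResponse K ω)).det ≠ 0 := by
  set M := hG.lift * hK.lift with hM
  have h1 : ∀ τ : ℝ, 1 + RatFunc.C τ • (G * K) =
      (1 + constant τ • M).map properStable.subtype := fun τ => by
    have : M.map properStable.subtype = G * K := by
      rw [hM, Matrix.map_mul, hG.map_lift, hK.map_lift]
    rw [← this]
    ext i j
    simp [Matrix.one_apply, constant, apply_ite (Subtype.val : properStable → RatFunc ℝ)]
  have h2 : ∀ ω (τ : ℝ), (1 + (τ : ℂ) • (freqResponse G ω * freqResponse K ω)).det =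
      evalHom (imagAxis ω) (returnDet M τ) := fun ω τ => by
    rw [evalHom_returnDet, hM, Matrix.map_mul, hG.freqResponse_eq, hK.freqResponse_eq]
  simp only [h1, isUnit_and_isRHInf_inv_iff, h2]
  exact ⟨fun h ω _ τ hτ => h τ hτ _, fun h τ hτ =>
    evalHom_returnDet_ne_zero (fun τ hτ => evalHom_imagAxis_ne_zero fun ω hω => h ω hω τ hτ) hτ⟩

/-! ### Measurable choice of the multiplier -/

theorem IsMultiplier.smul {C Y : Matrix (Fin n) (Fin n) ℂ} (h : IsMultiplier C Y) {c : ℝ}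
    (hc : 0 < c) : IsMultiplier C ((c : ℂ) • Y) := by
  refine ⟨fun v hv => ?_, fun v => ?_⟩
  · rw [smul_mulVec, dotProduct_smul, smul_eq_mul, Complex.re_ofReal_mul]
    exact mul_pos hc (h.1 v hv)
  · rw [Matrix.smul_mul, smul_mulVec, dotProduct_smul, smul_eq_mul, Complex.re_ofReal_mul]
    exact mul_nonneg hc.le (h.2 v)

/-- The kernel projections of a continuous family of matrices depend measurably on the parameter, as
limits of resolvents. -/
theorem stronglyMeasurable_of_isKernelProjection {Ω : Type*} [TopologicalSpace Ω]
    [MeasurableSpace Ω] [OpensMeasurableSpace Ω] {C E : Ω → Matrix (Fin n) (Fin n) ℂ}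
    (hcont : Continuous C) (hC : ∀ ω, ∀ τ : ℝ, 0 < τ → (1 + (τ : ℂ) • C ω).det ≠ 0)
    (hE : ∀ ω, IsKernelProjection (C ω) (E ω)) : MeasureTheory.StronglyMeasurable E := by
  have : SecondCountableTopology (Matrix (Fin n) (Fin n) ℂ) :=
    inferInstanceAs (SecondCountableTopology (Fin n → Fin n → ℂ))
  have : TopologicalSpace.PseudoMetrizableSpace (Matrix (Fin n) (Fin n) ℂ) :=
    inferInstanceAs (TopologicalSpace.PseudoMetrizableSpace (Fin n → Fin n → ℂ))
  have hpos : ∀ k : ℕ, 0 < 1 / ((k : ℝ) + 1) := fun k => Nat.one_div_pos_of_nat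
  refine stronglyMeasurable_of_tendsto atTop
    (f := fun (k : ℕ) ω => ((1 / ((k : ℝ) + 1) : ℝ) : ℂ) •
      (C ω + ((1 / ((k : ℝ) + 1) : ℝ) : ℂ) • 1)⁻¹) (fun k => ?_) ?_
  · refine Continuous.stronglyMeasurable ?_
    simp only [inv_def, Ring.inverse_eq_inv']
    have h1 : Continuous fun ω => C ω + ((1 / ((k : ℝ) + 1) : ℝ) : ℂ) • 1 :=
      hcont.add continuous_const
    have h2 := h1.matrix_det.inv₀ fun ω => det_add_smul_one_ne_zero (hC ω) (hpos k)
    exact (h2.smul h1.matrix_adjugate).const_smul ((1 / ((k : ℝ) + 1) : ℝ) : ℂ)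
  · rw [tendsto_pi_nhds]
    intro ω
    have ht : Tendsto (fun k : ℕ => 1 / ((k : ℝ) + 1)) atTop (𝓝[>] 0) :=
      tendsto_nhdsWithin_iff.mpr ⟨tendsto_one_div_add_atTop_nhds_zero_nat,
        Eventually.of_forall hpos⟩
    exact ((hE ω).tendsto_smul_inv (hC ω)).comp ht

/-- Strict multipliers of a measurable family can be taken from a fixed dense sequence, because
strictness is an open condition. -/
theorem exists_stronglyMeasurable_strict {Ω : Type*} [MeasurableSpace Ω]
    {W : Ω → Matrix (Fin n) (Fin n) ℂ} (hWm : MeasureTheory.StronglyMeasurable W)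
    (hW : ∀ ω, ∀ t : ℝ, 0 ≤ t → (W ω + (t : ℂ) • 1).det ≠ 0) :
    ∃ Y : Ω → Matrix (Fin n) (Fin n) ℂ, MeasureTheory.StronglyMeasurable Y ∧
      ∀ ω, ∀ v : Fin n → ℂ, v ≠ 0 →
        0 < (star v ⬝ᵥ Y ω *ᵥ v).re ∧ 0 < (star v ⬝ᵥ (Y ω * W ω) *ᵥ v).re := by
  have : SecondCountableTopology (Matrix (Fin n) (Fin n) ℂ) :=
    inferInstanceAs (SecondCountableTopology (Fin n → Fin n → ℂ))
  have : TopologicalSpace.PseudoMetrizableSpace (Matrix (Fin n) (Fin n) ℂ) :=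
    inferInstanceAs (TopologicalSpace.PseudoMetrizableSpace (Fin n → Fin n → ℂ))
  let : MeasurableSpace (Matrix (Fin n) (Fin n) ℂ) := borel _
  have : BorelSpace (Matrix (Fin n) (Fin n) ℂ) := ⟨rfl⟩
  obtain ⟨D, hD⟩ := TopologicalSpace.exists_dense_seq (Matrix (Fin n) (Fin n) ℂ)
  have hopen := isOpen_setOf_re_pos (n := n)
  set S := {M : Matrix (Fin n) (Fin n) ℂ | ∀ v : Fin n → ℂ, v ≠ 0 → 0 < (star v ⬝ᵥ M *ᵥ v).re}
  have hp : ∀ ω, ∃ k, D k ∈ S ∧ D k * W ω ∈ S := fun ω => by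
    obtain ⟨Y, hY⟩ := exists_strictly_accretive_multiplier (hW ω)
    have hmul : Continuous fun Y : Matrix (Fin n) (Fin n) ℂ => Y * W ω := by fun_prop
    exact hD.exists_mem_open (hopen.inter (hopen.preimage hmul))
      ⟨Y, fun v hv => (hY v hv).1, fun v hv => (hY v hv).2⟩
  classical
  have hNm : Measurable fun ω => Nat.find (hp ω) := by
    refine measurable_find hp fun k => (MeasurableSet.const _).inter ?_
    have hmul : Continuous fun W : Matrix (Fin n) (Fin n) ℂ => D k * W := by fun_prop
    exact hWm.measurable (hopen.preimage hmul).measurableSet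
  refine ⟨fun ω => D (Nat.find (hp ω)), ?_, fun ω v hv => ?_⟩
  · have hDm : Measurable D := measurable_from_nat
    exact (hDm.comp hNm).stronglyMeasurable
  · have := Nat.find_spec (hp ω)
    exact ⟨this.1 v hv, this.2 v hv⟩

/-- Multipliers for a continuous family of matrices can be chosen measurably. -/
theorem exists_stronglyMeasurable_isMultiplier {Ω : Type*} [TopologicalSpace Ω] [MeasurableSpace Ω]
    [OpensMeasurableSpace Ω] {C : Ω → Matrix (Fin n) (Fin n) ℂ} (hcont : Continuous C)
    (hC : ∀ ω, ∀ τ : ℝ, 0 < τ → (1 + (τ : ℂ) • C ω).det ≠ 0)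
    (hss : ∀ ω, Module.End.HasEigenvalue (C ω).toLin' 0 → IsSemisimpleEigenvalue (C ω) 0) :
    ∃ Y : Ω → Matrix (Fin n) (Fin n) ℂ,
      MeasureTheory.StronglyMeasurable Y ∧ ∀ ω, IsMultiplier (C ω) (Y ω) := by
  have : SecondCountableTopology (Matrix (Fin n) (Fin n) ℂ) :=
    inferInstanceAs (SecondCountableTopology (Fin n → Fin n → ℂ))
  have : TopologicalSpace.PseudoMetrizableSpace (Matrix (Fin n) (Fin n) ℂ) :=
    inferInstanceAs (TopologicalSpace.PseudoMetrizableSpace (Fin n → Fin n → ℂ))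
  choose E hE using fun ω => exists_isKernelProjection (hss ω)
  have hEm := stronglyMeasurable_of_isKernelProjection hcont hC hE
  have hWm : MeasureTheory.StronglyMeasurable fun ω => C ω + E ω :=
    hcont.stronglyMeasurable.add hEm
  obtain ⟨Y, hYm, hY⟩ := exists_stronglyMeasurable_strict hWm
    fun ω => (hE ω).det_add_ne_zero (hC ω)
  have hmul : ∀ ω, IsMultiplier (C ω) (extendMultiplier (E ω) (Y ω)) := fun ω =>
    (hE ω).isMultiplier_extendMultiplier (hY ω)
  refine ⟨fun ω => extendMultiplier (E ω) (Y ω), ?_, hmul⟩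
  have hc : Continuous fun p : Matrix (Fin n) (Fin n) ℂ × Matrix (Fin n) (Fin n) ℂ =>
      extendMultiplier p.1 p.2 := by
    unfold extendMultiplier
    fun_prop
  exact hc.comp_stronglyMeasurable (f := fun ω => (E ω, Y ω)) (hEm.prodMk hYm)

open scoped Matrix.Norms.L2Operator in
/-- The multiplier `H = A* Y*`, normalised to be bounded. -/
def normalizedMultiplier (A Y : Matrix (Fin n) (Fin n) ℂ) : Matrix (Fin n) (Fin n) ℂ :=
  (((1 + ‖Aᴴ * Yᴴ‖)⁻¹ : ℝ) : ℂ) • (Aᴴ * Yᴴ)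

open scoped Matrix.Norms.L2Operator in
theorem IsMultiplier.exists_quadSeparates {A B Y : Matrix (Fin n) (Fin n) ℂ}
    (h : IsMultiplier (A * B) Y) :
    ∃ ε : ℝ, 0 < ε ∧ QuadSeparates A B (phaseMultiplier (normalizedMultiplier A Y)) ε := by
  have e : ∀ c : ℝ, (c : ℂ) • (Aᴴ * Yᴴ) = Aᴴ * ((c : ℂ) • Y)ᴴ := fun c => by
    simp [conjTranspose_smul]
  rw [normalizedMultiplier, e]
  have h' := h.smul (c := (1 + ‖Aᴴ * Yᴴ‖)⁻¹) (by positivity)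
  exact PhaseMultiplier.exists_quadSeparates h'.1 h'.2

open scoped Matrix.Norms.L2Operator in
theorem isLInf_normalizedMultiplier {A Y : ℝ → Matrix (Fin n) (Fin n) ℂ} (hA : Continuous A)
    (hY : MeasureTheory.StronglyMeasurable Y) :
    IsLInf fun ω => normalizedMultiplier (A ω) (Y ω) := by
  have hc : Continuous fun p : Matrix (Fin n) (Fin n) ℂ × Matrix (Fin n) (Fin n) ℂ =>
      normalizedMultiplier p.1 p.2 := by
    unfold normalizedMultiplier
    have h1 : Continuous fun p : Matrix (Fin n) (Fin n) ℂ × Matrix (Fin n) (Fin n) ℂ =>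
      p.1ᴴ * p.2ᴴ := by fun_prop
    refine (Complex.continuous_ofReal.comp ((continuous_const.add h1.norm).inv₀ fun p => ?_)).smul h1
    exact (add_pos_of_pos_of_nonneg one_pos (norm_nonneg _)).ne'
  refine MeasureTheory.memLp_top_of_bound
    (hc.comp_stronglyMeasurable (hA.stronglyMeasurable.prodMk hY)).aestronglyMeasurable 1
    (Eventually.of_forall fun ω => ?_)
  rw [normalizedMultiplier, norm_smul, Complex.norm_real, Real.norm_of_nonneg (by positivity),
    inv_mul_le_one₀ (by positivity)]
  linarith

/-- If `1 + τ G K` is nonsingular on the extended imaginary axis for all `τ > 0`, and the eigenvalue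
`0` of `G K` is semi-simple there, then an essentially bounded multiplier exists. -/
theorem exists_multiplier {G K : Matrix (Fin n) (Fin n) (RatFunc ℝ)} (hG : IsRHInf G)
    (hK : IsRHInf K)
    (hss : ∀ ω ∈ nonnegFreq,
      Module.End.HasEigenvalue (freqResponse G ω * freqResponse K ω).toLin' 0 →
        IsSemisimpleEigenvalue (freqResponse G ω * freqResponse K ω) 0)
    (h : ∀ ω ∈ nonnegFreq, ∀ τ : ℝ, 0 < τ →
      (1 + (τ : ℂ) • (freqResponse G ω * freqResponse K ω)).det ≠ 0) :
    ∃ H : OnePoint ℝ → Matrix (Fin n) (Fin n) ℂ,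
      IsLInf (fun ω : ℝ => H (ω : OnePoint ℝ)) ∧
      ∀ ω ∈ nonnegFreq, ∃ ε : ℝ, 0 < ε ∧
        QuadSeparates (freqResponse G ω) (freqResponse K ω) (phaseMultiplier (H ω)) ε := by
  -- nothing is assumed at negative frequencies, so the response is made even in `ω`
  have habs : ∀ ω : ℝ, ((|ω| : ℝ) : OnePoint ℝ) ∈ nonnegFreq := fun ω =>
    Set.mem_insert_of_mem _ ⟨|ω|, abs_nonneg ω, rfl⟩
  have hinf : OnePoint.infty ∈ nonnegFreq := Set.mem_insert _ _
  have hc : Continuous fun ω : ℝ => ((|ω| : ℝ) : OnePoint ℝ) :=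
    OnePoint.continuous_coe.comp continuous_abs
  have hA : Continuous fun ω : ℝ => freqResponse G (|ω| : ℝ) := hG.continuous_freqResponse.comp hc
  have hB : Continuous fun ω : ℝ => freqResponse K (|ω| : ℝ) := hK.continuous_freqResponse.comp hc
  have hAB : Continuous fun ω : ℝ => freqResponse G (|ω| : ℝ) * freqResponse K (|ω| : ℝ) :=
    hA.mul hB
  obtain ⟨Y, hYm, hY⟩ := exists_stronglyMeasurable_isMultiplier hAB
    (fun ω => h _ (habs ω)) (fun ω => hss _ (habs ω))
  obtain ⟨Y', -, hY'⟩ := exists_stronglyMeasurable_isMultiplier (Ω := Unit)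
    (continuous_const (y := freqResponse G OnePoint.infty * freqResponse K OnePoint.infty))
    (fun _ => h _ hinf) (fun _ => hss _ hinf)
  refine ⟨fun ω => ω.elim (normalizedMultiplier (freqResponse G OnePoint.infty) (Y' ()))
    fun ω => normalizedMultiplier (freqResponse G (|ω| : ℝ)) (Y ω),
    isLInf_normalizedMultiplier hA hYm, ?_⟩
  rintro _ (rfl | ⟨ω, hω, rfl⟩)
  · exact (hY' ()).exists_quadSeparates
  · have hsep := (hY ω).exists_quadSeparates
    rw [abs_of_nonneg (Set.mem_Ici.mp hω)] at hsep
    change ∃ ε : ℝ, 0 < ε ∧ QuadSeparates _ _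
      (phaseMultiplier (normalizedMultiplier (freqResponse G (|ω| : ℝ)) (Y ω))) ε
    rw [abs_of_nonneg (Set.mem_Ici.mp hω)]
    exact hsep

end PhaseMultiplier
end

theorem mainTheorem5 (n : ℕ) (G K : Matrix (Fin n) (Fin n) (RatFunc ℝ))
    (hG : PhaseMultiplier.IsRHInf G) (hK : PhaseMultiplier.IsRHInf K)
    (hss : ∀ ω ∈ PhaseMultiplier.nonnegFreq,
      Module.End.HasEigenvalue (Matrix.toLin'
        (PhaseMultiplier.freqResponse G ω * PhaseMultiplier.freqResponse K ω)) 0 →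
      PhaseMultiplier.IsSemisimpleEigenvalue
        (PhaseMultiplier.freqResponse G ω * PhaseMultiplier.freqResponse K ω) 0) :
    (∀ τ : ℝ, 0 < τ →
      IsUnit (1 + RatFunc.C τ • (G * K)) ∧
        PhaseMultiplier.IsRHInf (1 + RatFunc.C τ • (G * K))⁻¹) ↔
    ∃ H : OnePoint ℝ → Matrix (Fin n) (Fin n) ℂ,
      PhaseMultiplier.IsLInf (fun ω : ℝ => H (ω : OnePoint ℝ)) ∧
      ∀ ω ∈ PhaseMultiplier.nonnegFreq, ∃ ε : ℝ, 0 < ε ∧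
        PhaseMultiplier.QuadSeparates (PhaseMultiplier.freqResponse G ω)
          (PhaseMultiplier.freqResponse K ω) (PhaseMultiplier.phaseMultiplier (H ω)) ε := by
  rw [PhaseMultiplier.stability_iff_forall_freq hG hK]
  refine ⟨PhaseMultiplier.exists_multiplier hG hK hss, ?_⟩
  rintro ⟨H, -, hH⟩ ω hω τ hτ
  obtain ⟨ε, hε, hsep⟩ := hH ω hω
  exact hsep.det_ne_zero hε hτ
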